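/- Let $\mathbb{H}$ be the upper half plane, and write $q=e^{2\pi i\tau}$, $\zeta=e^{2\pi i z}$ for $\tau\in\mathbb{H}$, $z\in\mathbb{C}$. For integers $k$ and $m\ge 0$, a holomorphic weak Jacobi form of weight $k$ and index $m$ on the full Jacobi group $SL_2(\mathbb{Z})\ltimes\mathbb{Z}^2$ is a holomorphic function $\phi:\mathbb{H}\times\mathbb{C}\to\mathbb{C}$ such that $$\phi\left(\frac{a\tau+b}{c\tau+d},\frac{z}{c\tau+d}\right)=(c\tau+d)^k e^{2\pi i m c z^2/(c\tau+d)}\phi(\tau,z)\quad\text{for all }\begin{pmatrix}a&b\\c&d\end{pmatrix}\in SL_2(\mathbb{Z}),$$ $$\phi(\tau,z+u\tau+v)=e^{-2\pi i m(u^2\tau+2uz)}\phi(\tau,z)\quad\text{for all }u,v\in\mathbb{Z},$$ and whose Fourier expansion $\phi(\tau,z)=\sum_{n,r\in\mathbb{Z}}c(n,r)q^n\zeta^r$ satisfies $c(n,r)=0$ unless $n\ge 0$. It is a (true) Jacobi form if moreover $c(n,r)=0$ unless $r^2\le 4mn$. Proposition. Let $\phi(\tau,z)=\sum_{n,r}c(n,r)q^n\zeta^r$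 be a holomorphic weak Jacobi form of weight $k$ and index $m$ on the full Jacobi group, where $k\ge 4$ and $1\le m\le 4$. Then $\phi$ is a Jacobi form if and only if $c(0,r)=0$ for all $r\ne 0$. -/

import Mathlib

open UpperHalfPlane

/-- `φ(τ, z) = ∑_{n, r ∈ ℤ} c(n, r) q^n ζ^r` on all of `ℍ × ℂ`, with `q = e^{2πiτ}` and
`ζ = e^{2πiz}` (unconditional, i.e. absolute, convergence at every point). -/
def HasFourierJacobiExpansion (φ : ℍ → ℂ → ℂ) (c : ℤ → ℤ → ℂ) : Prop :=
  ∀ (τ : ℍ) (z : ℂ),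
    HasSum (fun p : ℤ × ℤ =>
      c p.1 p.2 * Complex.exp (2 * Real.pi * Complex.I * (τ : ℂ)) ^ p.1 *
        Complex.exp (2 * Real.pi * Complex.I * z) ^ p.2) (φ τ z)

/-- Holomorphic weak Jacobi forms of weight `k` and index `m` on the full Jacobi group
`SL₂(ℤ) ⋉ ℤ²`. -/
structure IsWeakJacobiForm (k : ℤ) (m : ℕ) (φ : ℍ → ℂ → ℂ) : Prop where
  /-- `φ` is holomorphic, as a function of two variables, on `ℍ × ℂ`. -/
  holomorphic : DifferentiableOn ℂ (fun p : ℂ × ℂ => φ (ofComplex p.1) p.2)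
    {p : ℂ × ℂ | 0 < p.1.im}
  /-- `φ(γτ, z / (cτ + d)) = (cτ + d)^k e^{2πi m c z² / (cτ + d)} φ(τ, z)`. -/
  modular : ∀ (γ : Matrix.SpecialLinearGroup (Fin 2) ℤ) (τ : ℍ) (z : ℂ),
    φ (γ • τ) (z / ((γ 1 0 : ℂ) * (τ : ℂ) + (γ 1 1 : ℂ))) =
      ((γ 1 0 : ℂ) * (τ : ℂ) + (γ 1 1 : ℂ)) ^ k *
        Complex.exp (2 * Real.pi * Complex.I * (m : ℂ) * (γ 1 0 : ℂ) * z ^ 2 /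
          ((γ 1 0 : ℂ) * (τ : ℂ) + (γ 1 1 : ℂ))) * φ τ z
  /-- `φ(τ, z + uτ + v) = e^{-2πi m (u²τ + 2uz)} φ(τ, z)`. -/
  elliptic : ∀ (u v : ℤ) (τ : ℍ) (z : ℂ),
    φ τ (z + (u : ℂ) * (τ : ℂ) + (v : ℂ)) =
      Complex.exp (-(2 * Real.pi * Complex.I * (m : ℂ) *
        ((u : ℂ) ^ 2 * (τ : ℂ) + 2 * (u : ℂ) * z))) * φ τ z
  /-- The Fourier coefficients satisfy `c(n, r) = 0` unless `0 ≤ n`. -/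
  fourier : ∃ c : ℤ → ℤ → ℂ, HasFourierJacobiExpansion φ c ∧
    ∀ n r : ℤ, ¬ 0 ≤ n → c n r = 0

/-- (True) Jacobi forms of weight `k` and index `m` on the full Jacobi group: weak Jacobi forms
whose Fourier coefficients satisfy `c(n, r) = 0` unless `r² ≤ 4mn`. -/
structure IsJacobiForm (k : ℤ) (m : ℕ) (φ : ℍ → ℂ → ℂ) : Prop
    extends IsWeakJacobiForm k m φ where
  fourier_jacobi : ∃ c : ℤ → ℤ → ℂ, HasFourierJacobiExpansion φ c ∧
    ∀ n r : ℤ, ¬ r ^ 2 ≤ 4 * (m : ℤ) * n → c n r = 0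

/-! By the elliptic law (`IsWeakJacobiForm.coeff_shift`), a coefficient with `r² > 4mn` equals some
`c l s` with `|s| ≤ m` and `s² > 4ml`. If `l < 0` it vanishes by weakness; if `l = 0` then `s ≠ 0`
and the hypothesis on `c 0 s` applies; `l > 0` is impossible, since `4ml ≥ 4m ≥ m² ≥ s²` when `m ≤
4`. Uniqueness of expansions lets one fixed `c` serve throughout. -/

lemma HasSum.of_forall_eq {ι : Type*} {f g : ι → ℂ} {a : ℂ} (hg : HasSum g a)
    (h : ∀ i, f i = g i) : HasSum f a := by
  rwa [funext h]

/-- An absolutely convergent trigonometric series that vanishes identically has zero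
coefficients. -/
lemma eq_zero_of_hasSum_exp_zpow {a : ℤ → ℂ}
    (h : ∀ x : ℝ, HasSum (fun n : ℤ => a n * Complex.exp (2 * Real.pi * Complex.I * x) ^ n) 0)
    (N : ℤ) : a N = 0 := by
  have hs : Summable fun n => ‖a n‖ := by
    simpa using (h 0).summable.norm
  -- Twisting by `e^{-2πiNx}` makes integration over `[0, 1]` isolate `a N`.
  let f : ℤ → C(ℝ, ℂ) := fun n =>
    ⟨fun x => a n * Complex.exp ((2 * Real.pi * Complex.I * ((n - N : ℤ) : ℂ)) * x), by fun_prop⟩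
  have hnorm : ∀ (n : ℤ) (x : ℝ), ‖f n x‖ = ‖a n‖ := by
    intro n x
    have : (2 * Real.pi * Complex.I * ((n - N : ℤ) : ℂ)) * x =
        ((2 * Real.pi * (n - N : ℤ) * x : ℝ) : ℂ) * Complex.I := by
      push_cast; ring
    simp only [f, ContinuousMap.coe_mk, norm_mul, this, Complex.norm_exp_ofReal_mul_I, mul_one]
  have hsum := intervalIntegral.hasSum_intervalIntegral_of_summable_norm (a := 0) (b := 1) (f := f)
    (hs.of_nonneg_of_le (fun _ => norm_nonneg _) fun n =>
      (ContinuousMap.norm_le _ (norm_nonneg _)).2 fun x => (hnorm n x).le)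
  have hzero : ∀ x : ℝ, ∑' n, f n x = 0 := by
    intro x
    have := (h x).mul_right (Complex.exp (-(2 * Real.pi * Complex.I * N * x)))
    rw [zero_mul] at this
    refine HasSum.tsum_eq ?_
    refine this.of_forall_eq fun n => ?_
    simp only [f, ContinuousMap.coe_mk]
    rw [← Complex.exp_int_mul, mul_assoc (a n), ← Complex.exp_add]
    congr 2
    push_cast; ring
  have hint : ∀ n, ∫ x in (0 : ℝ)..1, f n x = if n = N then a N else 0 := by
    intro n
    simp only [f, ContinuousMap.coe_mk]
    rw [intervalIntegral.integral_const_mul]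
    split_ifs with hn
    · simp [hn]
    · have hne : (2 * Real.pi * Complex.I * ((n - N : ℤ) : ℂ)) ≠ 0 :=
        mul_ne_zero Complex.two_pi_I_ne_zero (Int.cast_ne_zero.2 (sub_ne_zero.2 hn))
      rw [integral_exp_mul_complex hne]
      have : Complex.exp (2 * Real.pi * Complex.I * ((n - N : ℤ) : ℂ)) = 1 := by
        rw [mul_comm]; exact Complex.exp_int_mul_two_pi_mul_I _
      rw [Complex.ofReal_one, Complex.ofReal_zero, mul_one, mul_zero, this, Complex.exp_zero,
        sub_self, zero_div, mul_zero]
  simp only [hzero, hint, intervalIntegral.integral_zero] at hsum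
  exact (hasSum_ite_eq N (a N)).unique hsum

/-- A Fourier–Jacobi expansion of the zero function has zero coefficients. -/
lemma HasFourierJacobiExpansion.eq_zero {c : ℤ → ℤ → ℂ}
    (h : HasFourierJacobiExpansion (fun _ _ => 0) c) (n r : ℤ) : c n r = 0 := by
  have key : ∀ x : ℝ, ∀ n : ℤ, ∑' r : ℤ, c n r * Complex.exp (2 * Real.pi * Complex.I * x) ^ r *
      Complex.exp (2 * Real.pi * Complex.I * (I : ℂ)) ^ n = 0 := by
    intro x
    refine eq_zero_of_hasSum_exp_zpow fun t => ?_
    -- On the line `τ = t + i` the expansion is a Fourier series in `t`, with the sums over `r` as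
    -- coefficients.
    have hs := h ((t : ℝ) +ᵥ I) x
    have hf := HasSum.prod_fiberwise hs fun n => (hs.summable.prod_factor n).hasSum
    convert hf using 2 with n
    rw [← tsum_mul_right]
    refine tsum_congr fun r => ?_
    rw [UpperHalfPlane.coe_vadd, mul_add, Complex.exp_add, mul_zpow]
    ring
  have hsumm : ∀ x : ℝ, Summable fun r : ℤ =>
      c n r * Complex.exp (2 * Real.pi * Complex.I * x) ^ r *
      Complex.exp (2 * Real.pi * Complex.I * (I : ℂ)) ^ n := fun x => by
    refine ((h I x).summable.prod_factor n).congr fun r => ?_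
    ring
  have h0 := eq_zero_of_hasSum_exp_zpow
    (a := fun r => c n r * Complex.exp (2 * Real.pi * Complex.I * (I : ℂ)) ^ n)
    (fun x => by
      have := (hsumm x).hasSum
      rw [key x n] at this
      convert this using 2 with r
      ring) r
  exact (mul_eq_zero.1 h0).resolve_right (zpow_ne_zero _ (Complex.exp_ne_zero _))

/-- The coefficients of a Fourier–Jacobi expansion are unique. -/
lemma HasFourierJacobiExpansion.unique {φ : ℍ → ℂ → ℂ} {c d : ℤ → ℤ → ℂ}
    (hc : HasFourierJacobiExpansion φ c) (hd : HasFourierJacobiExpansion φ d) (n r : ℤ) :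
    c n r = d n r := by
  refine sub_eq_zero.1 (HasFourierJacobiExpansion.eq_zero (c := fun n r => c n r - d n r) ?_ n r)
  intro τ z
  have := (hc τ z).sub (hd τ z)
  rw [sub_self] at this
  refine this.of_forall_eq fun p => ?_
  ring

/-- The shear `(n, r) ↦ (n - ru, r)` of the index set. -/
def shearEquiv (u : ℤ) : ℤ × ℤ ≃ ℤ × ℤ where
  toFun p := (p.1 - p.2 * u, p.2)
  invFun p := (p.1 + p.2 * u, p.2)
  left_inv p := by simp
  right_inv p := by simp

/-- The elliptic transformation law on Fourier coefficients:
`c(n, r)` depends only on `r` modulo `2m` and on `4mn - r²`. -/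
lemma IsWeakJacobiForm.coeff_shift {k : ℤ} {m : ℕ} {φ : ℍ → ℂ → ℂ} {c : ℤ → ℤ → ℂ}
    (hφ : IsWeakJacobiForm k m φ) (hc : HasFourierJacobiExpansion φ c) (n r u : ℤ) :
    c n r = c (n + r * u + m * u ^ 2) (r + 2 * m * u) := by
  -- Expand `φ(τ, z + uτ)` twice: by substitution (`h1`) and by the elliptic law (`h2`).
  have h1 : HasFourierJacobiExpansion (fun τ z => φ τ (z + u * τ)) fun n r => c (n - r * u) r := by
    intro τ z
    have := (shearEquiv u).hasSum_iff.2 (hc τ (z + u * τ))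
    convert this using 2 with p
    simp only [Function.comp_apply, shearEquiv, Equiv.coe_fn_mk]
    simp only [← Complex.exp_int_mul, mul_assoc, ← Complex.exp_add]
    congr 2
    push_cast; ring
  have h2 : HasFourierJacobiExpansion (fun τ z => φ τ (z + u * τ))
      fun n r => c (n + m * u ^ 2) (r + 2 * m * u) := by
    intro τ z
    have hell := hφ.elliptic u 0 τ z
    rw [Int.cast_zero, add_zero] at hell
    have := (Equiv.addRight ((m * u ^ 2, 2 * m * u) : ℤ × ℤ)).hasSum_iff.2
      ((hc τ z).mul_left (Complex.exp (-(2 * Real.pi * Complex.I * (m : ℂ) *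
        ((u : ℂ) ^ 2 * (τ : ℂ) + 2 * (u : ℂ) * z)))))
    beta_reduce
    rw [hell]
    refine this.of_forall_eq fun p => ?_
    simp only [Function.comp_apply, Equiv.coe_addRight, Prod.fst_add, Prod.snd_add]
    simp only [← Complex.exp_int_mul]
    rw [mul_assoc (c _ _), mul_assoc (c _ _), ← Complex.exp_add, ← Complex.exp_add,
      mul_left_comm (Complex.exp _) (c _ _), ← Complex.exp_add]
    congr 2
    push_cast; ring
  have := h1.unique h2 (n + r * u) r
  simpa using this

/-- Every residue class modulo `2m` has a representative `s` with `s² ≤ m²`. -/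
lemma exists_sq_add_two_mul_le (m : ℕ) (hm : 1 ≤ m) (r : ℤ) :
    ∃ u : ℤ, (r + 2 * m * u) ^ 2 ≤ (m : ℤ) ^ 2 := by
  have hpos : (0 : ℤ) < 2 * m := by omega
  -- This `u` gives `r + 2mu = (r + m) % (2m) - m`, which lies in `[-m, m)`.
  refine ⟨-((r + m) / (2 * m)), sq_le_sq' ?_ ?_⟩
  · linarith [Int.emod_add_mul_ediv (r + m) (2 * m), Int.emod_nonneg (r + m) hpos.ne']
  · linarith [Int.emod_add_mul_ediv (r + m) (2 * m), Int.emod_lt_of_pos (r + m) hpos]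

theorem mainTheorem6 (k : ℤ) (m : ℕ) (hk : 4 ≤ k) (hm1 : 1 ≤ m) (hm4 : m ≤ 4)
    (φ : ℍ → ℂ → ℂ) (c : ℤ → ℤ → ℂ) (hφ : IsWeakJacobiForm k m φ)
    (hc : HasFourierJacobiExpansion φ c) :
    IsJacobiForm k m φ ↔ ∀ r : ℤ, r ≠ 0 → c 0 r = 0 := by
  constructor
  · intro hJ r hr
    obtain ⟨d, hd, hd0⟩ := hJ.fourier_jacobi
    rw [hc.unique hd]
    refine hd0 0 r ?_
    rw [mul_zero, not_le]
    positivity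
  · intro h0
    refine ⟨hφ, c, hc, fun n r hnr => ?_⟩
    obtain ⟨u, hu⟩ := exists_sq_add_two_mul_le m hm1 r
    rw [hφ.coeff_shift hc n r u]
    set s : ℤ := r + 2 * m * u with hs
    set l : ℤ := n + r * u + m * u ^ 2 with hl
    have hdisc : s ^ 2 - 4 * m * l = r ^ 2 - 4 * m * n := by rw [hs, hl]; ring
    rcases lt_trichotomy l 0 with hneg | hzero | hpos
    · obtain ⟨d, hd, hd0⟩ := hφ.fourier
      rw [hc.unique hd]
      exact hd0 l s hneg.not_ge
    · rw [hzero] at hdisc ⊢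
      refine h0 s fun hs0 => ?_
      rw [hs0] at hdisc
      linarith
    · have hm1' : (1 : ℤ) ≤ m := by exact_mod_cast hm1
      have hm4' : (m : ℤ) ≤ 4 := by exact_mod_cast hm4
      -- The only use of `m ≤ 4`: it gives `m² ≤ 4m`.
      nlinarith [mul_le_mul_of_nonneg_left (show (1 : ℤ) ≤ l from hpos) (by linarith : (0 : ℤ) ≤ 4 * m)]
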